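/- Let $\mathcal A$ be a unital C$^*$-algebra. Regard $\mathcal A^{**}$ as the enveloping von Neumann algebra of $\mathcal A$, i.e. the bicommutant of $\mathcal A$ in its universal representation on the Hilbert space $H_u$ (the Hilbert sum of the GNS spaces of all states of $\mathcal A$). Let $\mathcal D=\{z\in\mathcal A:\|z\|<1\}$, and let $\mathcal U(\theta)$ be the group of invertible matrices $\tilde g\in M_2(\mathcal A)$ that preserve the form $\theta(x,y)=x_1^*y_1-x_2^*y_2$ on $\mathcal A^2$. It acts on $\mathcal D$ by $\tilde g\cdot z=(g_{21}+g_{22}z)(g_{11}+g_{12}z)^{-1}$. The geodesics of $\mathcal D$ are the curves $$\delta(t)=\tilde g\cdot\left(\exp\left(t\begin{pmatrix}0&\alpha^*\\ \alpha&0\end{pmatrix}\right)\cdot 0\right),\qquad t\in\mathbb R,$$ with $\tilde g\in\mathcal U(\theta)$ and $\alpha\in\mathcal A$. An element $a\in\mathcal A^{**}$ is the $+\infty$ limit point of $\delta$ if $\delta(t)\to a$ as $t\to+\infty$ in the strong operator topology of $H_u$. 1. If $a\in\mathcal A^{**}$ is the $+\infty$ limit point of a geodesic in $\mathcal D$, then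 there are a positive invertible element $h\in\mathcal A^{**}$ and a projection $q\in\mathcal A^{**}$ such that $1-a^*a=hqh$. Consequently the defect operator $1-a^*a$ has closed range in $H_u$. 2. In particular, if $\mathcal A$ is infinite-dimensional, then not every element of norm one is such a limit point: there is $a\in\mathcal A^{**}$ with $\|a\|=1$ for which $1-a^*a$ does not have closed range, and this $a$ is not the $+\infty$ limit point of any geodesic in $\mathcal D$. -/

import Mathlib

namespace OperatorDisk

open Filter Topology

noncomputable section

universe u

/-! ### The disk of a unital C*-algebra and its geodesics -/

section Disk

variable {A : Type u} [CStarAlgebra A]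

/-- The `A`-valued form `θ(x, y) = x₁* y₁ - x₂* y₂` on `A²`. -/
def theta (x y : Fin 2 → A) : A :=
  star (x 0) * y 0 - star (x 1) * y 1

variable (A) in
/-- The unitary group `U(θ)` of the form `θ`: the invertible `2 × 2` matrices over `A` which, acting
on columns by left multiplication, preserve `θ`. -/
def thetaUnitary : Set (Matrix (Fin 2) (Fin 2) A)ˣ :=
  {g | ∀ x y : Fin 2 → A,
    theta ((g : Matrix (Fin 2) (Fin 2) A).mulVec x) ((g : Matrix (Fin 2) (Fin 2) A).mulVec y) =
      theta x y}

/-- The action by fractional linear maps, `g · z = (g₂₁ + g₂₂ z) (g₁₁ + g₁₂ z)⁻¹`. The inverse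
exists whenever `g ∈ U(θ)` and `‖z‖ < 1`. -/
def mobius (g : Matrix (Fin 2) (Fin 2) A) (z : A) : A :=
  (g 1 0 + g 1 1 * z) * Ring.inverse (g 0 0 + g 0 1 * z)

/-- The curve `t ↦ exp (t X) · 0`, `X` the matrix with rows `(0, α*)` and `(α, 0)`: the geodesic of
the disk which starts at `0` with velocity `α`. -/
def geodesicFromZero (α : A) (t : ℝ) : A :=
  mobius (NormedSpace.exp (t • (!![0, star α; α, 0] : Matrix (Fin 2) (Fin 2) A))) 0

/-- The geodesics of the disk `{z : ‖z‖ < 1}` (for the canonical connection of this homogeneous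
space of `U(θ)`): the translates by `U(θ)` of the geodesics which start at `0`. Constant geodesics
(`α = 0`) are included. -/
def IsGeodesic (δ : ℝ → A) : Prop :=
  ∃ g ∈ thetaUnitary A, ∃ α : A,
    ∀ t : ℝ, δ t = mobius (g : Matrix (Fin 2) (Fin 2) A) (geodesicFromZero α t)

end Disk

/-! ### The universal representation and the enveloping von Neumann algebra -/

section Universal

open scoped ComplexOrder

variable (A : Type u) [CStarAlgebra A] [PartialOrder A] [StarOrderedRing A]

/-- The states of `A`. -/
abbrev State : Type u := {f : A →ₚ[ℂ] ℂ // f 1 = 1}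

/-- The Hilbert space of the universal representation: the Hilbert sum of the GNS spaces of all
states of `A`. -/
abbrev UniversalSpace : Type u := lp (fun f : State A => f.1.GNS) 2

variable {A}

theorem norm_gns_le (a : A) (f : State A) : ‖f.1.gnsStarAlgHom a‖ ≤ ‖a‖ :=
  NonUnitalStarAlgHom.norm_apply_le f.1.gnsStarAlgHom a

/-- The universal representation of `A`: `a` acts on each summand by the GNS representation. -/
def universalRep (a : A) : UniversalSpace A →L[ℂ] UniversalSpace A :=
  lp.mapCLM 2 (fun f : State A => f.1.gnsStarAlgHom a) (norm_nonneg a) (norm_gns_le a)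

variable (A)

/-- The enveloping von Neumann algebra `A**`: the bicommutant of `A` in its universal
representation. -/
def Bidual : VonNeumannAlgebra (UniversalSpace A) where
  toStarSubalgebra :=
    StarSubalgebra.centralizer ℂ
      (StarSubalgebra.centralizer ℂ (Set.range (universalRep (A := A))) :
        Set (UniversalSpace A →L[ℂ] UniversalSpace A))
  centralizer_centralizer' := by
    change Set.centralizer (Set.centralizer
      ((StarSubalgebra.centralizer ℂ
        (StarSubalgebra.centralizer ℂ (Set.range (universalRep (A := A))) :
          Set (UniversalSpace A →L[ℂ] UniversalSpace A)) :
        StarSubalgebra ℂ (UniversalSpace A →L[ℂ] UniversalSpace A)) :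
        Set (UniversalSpace A →L[ℂ] UniversalSpace A))) = _
    rw [StarSubalgebra.coe_centralizer_centralizer, Set.centralizer_centralizer_centralizer]
    exact (StarSubalgebra.coe_centralizer_centralizer ℂ _).symm

variable {A}

/-- `a ∈ A**` is the limit point at `+∞` of a geodesic of the disk, the limit being taken in the
strong operator topology of the universal representation. -/
def IsLimitPoint (a : Bidual A) : Prop :=
  ∃ δ : ℝ → A, IsGeodesic δ ∧
    ∀ ξ : UniversalSpace A,
      Tendsto (fun t : ℝ => universalRep (δ t) ξ) atTop
        (𝓝 ((a : UniversalSpace A →L[ℂ] UniversalSpace A) ξ))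

end Universal

end

end OperatorDisk

namespace OperatorDisk
open Filter Topology
open scoped ComplexOrder

/-! Write the geodesic as `(N E) · 0` with `N` in `U(θ)` and `E = exp (t X)`, and let `x` be the
upper left entry of `N E`. Preservation of `θ` gives `1 - δ* δ = (x⁻¹)* x⁻¹` and `x⁻¹ = w (p - q
δ)`, where `w = cosh (t s)⁻¹`, `s = |α|`, and `p`, `q` are the adjoints of the first column of `N`
(`IsGeodesic.exists_factorization`). All dependence on `t` besides `δ` sits in the contraction `w`,
which in effect tends to the projection onto `ker s`.

In the strong limit `p - q δ` becomes `M = p - q a`, invertible because `‖p⁻¹ q‖ < 1` and `‖a‖ ≤ 1`.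
Hence `1 - a* a = M* T M`, where `T` is the limit of the forms `‖w η‖²` and is a projection
(`isStarProjection_of_tendsto`, `IsGeodesic.exists_defect_eq`). The polar decomposition of `M` turns
this into `h q h`, whose range is closed.

For the second claim, an infinite-dimensional C*-algebra has a self-adjoint element with infinite
spectrum (`exists_isSelfAdjoint_infinite_spectrum`), and the spectrum accumulates at one of its
points `l`. A function of that element with peak value 1 exactly at `l` has a defect whose spectrum
accumulates at 0. In the universal representation spectral values are eigenvalues
(`exists_unit_eigenvector`), so the defect has nonzero eigenvalues tending to 0, which a closed
range forbids. -/

theorem subset_bicommutant {B : Type*} [Ring B] [StarRing B] [Algebra ℂ B] [StarModule ℂ B]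
    (s : Set B) :
    s ⊆ (StarSubalgebra.centralizer ℂ (StarSubalgebra.centralizer ℂ s : Set B) : Set B) := by
  intro a ha
  rw [SetLike.mem_coe, StarSubalgebra.mem_centralizer_iff]
  intro y hy
  rw [SetLike.mem_coe, StarSubalgebra.mem_centralizer_iff] at hy
  obtain ⟨h1, h2⟩ := hy a ha
  refine ⟨h1.symm, ?_⟩
  simpa only [star_mul, star_star] using congrArg star h2

/-! ### The universal representation as a star homomorphism -/

section Universal
universe u
variable {A : Type u} [CStarAlgebra A] [PartialOrder A] [StarOrderedRing A]

theorem universalRep_apply (a : A) (ξ : UniversalSpace A) (f : State A) :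
    universalRep a ξ f = f.1.gnsStarAlgHom a (ξ f) := rfl

variable (A) in
/-- The universal representation as a unital star homomorphism. -/
noncomputable def universalHom : A →⋆ₐ[ℂ] (UniversalSpace A →L[ℂ] UniversalSpace A) where
  toFun := universalRep
  map_one' := by
    ext ξ f
    rw [universalRep_apply, map_one]; rfl
  map_mul' a b := by
    ext ξ f
    rw [universalRep_apply, map_mul]; rfl
  map_zero' := by
    ext ξ f
    rw [universalRep_apply, map_zero]; rfl
  map_add' a b := by
    ext ξ f
    rw [universalRep_apply, map_add]; rfl
  commutes' c := by
    ext ξ f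
    rw [universalRep_apply, AlgHomClass.commutes]; rfl
  map_star' a := by
    rw [ContinuousLinearMap.star_eq_adjoint, ContinuousLinearMap.eq_adjoint_iff]
    intro ξ η
    rw [lp.inner_eq_tsum, lp.inner_eq_tsum]
    congr 1
    ext f
    rw [universalRep_apply, universalRep_apply, map_star, ContinuousLinearMap.star_eq_adjoint,
      ContinuousLinearMap.adjoint_inner_left]

theorem universalRep_mem_bidual (a : A) : universalRep a ∈ Bidual A :=
  subset_bicommutant (Set.range universalRep) ⟨a, rfl⟩

end Universal

/-! ### Inverses and square roots in a von Neumann algebra -/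

section VonNeumann

variable {H : Type*} [NormedAddCommGroup H] [InnerProductSpace ℂ H] [CompleteSpace H]
  (S : VonNeumannAlgebra H)

/-- In this form, membership passes to inverses and to the functional calculus, since commutation
does. -/
theorem mem_vonNeumann_iff_commute {T : H →L[ℂ] H} :
    T ∈ S ↔ ∀ y ∈ S.commutant, Commute T y := by
  conv_lhs => rw [← S.commutant_commutant, VonNeumannAlgebra.mem_commutant_iff]
  exact ⟨fun h y hy => (h y hy).symm, fun h y hy => (h y hy).symm⟩

theorem inverse_mem_vonNeumann {u : (H →L[ℂ] H)ˣ} (hu : (u : H →L[ℂ] H) ∈ S) :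
    ((u⁻¹ : (H →L[ℂ] H)ˣ) : H →L[ℂ] H) ∈ S := by
  rw [mem_vonNeumann_iff_commute] at hu ⊢
  exact fun y hy => (hu y hy).units_inv_left

theorem sqrt_mem_vonNeumann {T : H →L[ℂ] H} (hT : T ∈ S) : CFC.sqrt T ∈ S := by
  rw [mem_vonNeumann_iff_commute] at hT ⊢
  exact fun y hy => (hT y hy).cfcₙ_nnreal _

end VonNeumann

/-! ### Congruences of projections, and projections as limits of forms -/

section LimitPoint

variable {H : Type*} [NormedAddCommGroup H] [InnerProductSpace ℂ H] [CompleteSpace H]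
  (S : VonNeumannAlgebra H)

/-- `M* T M` with `M` invertible and `T` a projection has the form `h q h` with `h` positive
invertible and `q` a projection. -/
theorem exists_positive_mul_projection_mul {T : H →L[ℂ] H} (hT : T ∈ S) (hproj : IsStarProjection T)
    (M : (H →L[ℂ] H)ˣ) (hM : (M : H →L[ℂ] H) ∈ S) :
    ∃ h q : S, (h : H →L[ℂ] H).IsPositive ∧ IsUnit h ∧ IsStarProjection q ∧
      star (M : H →L[ℂ] H) * T * M = h * q * h := by
  set N : H →L[ℂ] H := star (M : H →L[ℂ] H) * M with hN
  have hN0 : 0 ≤ N := star_mul_self_nonneg _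
  have hNS : N ∈ S := mul_mem (star_mem hM) hM
  set h := CFC.sqrt N with hh
  have hhS : h ∈ S := sqrt_mem_vonNeumann S hNS
  have hh0 : 0 ≤ h := CFC.sqrt_nonneg N
  have hhh : h * h = N := CFC.sqrt_mul_sqrt_self N
  have hNu : IsUnit N := M.isUnit.star.mul M.isUnit
  have hu : IsUnit h := by
    rw [← hhh] at hNu
    exact (Commute.refl h).isUnit_mul_iff.1 hNu |>.1
  obtain ⟨u, hu⟩ := hu
  have huS : (u : H →L[ℂ] H) ∈ S := hu ▸ hhS
  have husa : star (u : H →L[ℂ] H) = u := by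
    rw [hu]; exact (IsSelfAdjoint.of_nonneg hh0).star_eq
  have huisa : star ((u⁻¹ : (H →L[ℂ] H)ˣ) : H →L[ℂ] H) = ((u⁻¹ : (H →L[ℂ] H)ˣ) : H →L[ℂ] H) := by
    have : star u = u := Units.ext husa
    rw [← Units.coe_star, star_inv, this]
  have huiS := inverse_mem_vonNeumann S huS
  -- With `u = (M* M)^(1/2)`, the factor `M u⁻¹` is the unitary part of `M`; conjugating `T` by it
  -- gives the projection `q`.
  have key : (M : H →L[ℂ] H) * ↑u⁻¹ * (↑u⁻¹ * star (M : H →L[ℂ] H)) = 1 := by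
    have h1 : star M * M = u * u := by
      ext1
      rw [Units.val_mul, Units.val_mul, hu, hhh]; rfl
    have h2 : M * u⁻¹ * (u⁻¹ * star M) = 1 := by
      have : star M = u * u * M⁻¹ := by rw [← h1]; group
      rw [this]; group
    exact congrArg Units.val h2
  let q : H →L[ℂ] H := ↑u⁻¹ * star (M : H →L[ℂ] H) * T * (M * ↑u⁻¹)
  have hq : IsStarProjection q := by
    constructor
    · change q * q = q
      calc q * q = ↑u⁻¹ * star (M : H →L[ℂ] H) * T *
            ((M : H →L[ℂ] H) * ↑u⁻¹ * (↑u⁻¹ * star (M : H →L[ℂ] H))) * T * (M * ↑u⁻¹) := by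
            simp only [q, mul_assoc]
        _ = ↑u⁻¹ * star (M : H →L[ℂ] H) * (T * T) * (M * ↑u⁻¹) := by
            rw [key]; simp only [mul_assoc, one_mul]
        _ = q := by rw [hproj.isIdempotentElem.eq]
    · change star q = q
      simp only [q, star_mul, star_star, huisa, hproj.isSelfAdjoint.star_eq, mul_assoc]
  have hqS : q ∈ S := mul_mem (mul_mem (mul_mem huiS (star_mem hM)) hT) (mul_mem hM huiS)
  refine ⟨⟨u, huS⟩, ⟨q, hqS⟩, ?_, ?_, ?_, ?_⟩
  · change (u : H →L[ℂ] H).IsPositive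
    rw [hu]
    exact (ContinuousLinearMap.nonneg_iff_isPositive _).1 hh0
  · exact ⟨⟨⟨u, huS⟩, ⟨_, huiS⟩, Subtype.ext (u.mul_inv), Subtype.ext (u.inv_mul)⟩, rfl⟩
  · exact ⟨Subtype.ext hq.isIdempotentElem, Subtype.ext hq.isSelfAdjoint⟩
  · change star (M : H →L[ℂ] H) * T * M =
      (u : H →L[ℂ] H) * (↑u⁻¹ * star (M : H →L[ℂ] H) * T * (M * ↑u⁻¹)) * u
    simp [mul_assoc]

omit [CompleteSpace H] in
-- The range is `h` applied to the fixed space of `q`, that is, the preimage of a closed set under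
-- `h⁻¹`.
theorem isClosed_range_of_eq_mul_projection_mul {h q d : H →L[ℂ] H} (hu : IsUnit h)
    (hq : IsIdempotentElem q) (hd : d = h * q * h) : IsClosed (Set.range d) := by
  obtain ⟨u, rfl⟩ := hu
  have : Set.range d =
      ((u⁻¹ : (H →L[ℂ] H)ˣ) : H →L[ℂ] H) ⁻¹' {x | q x = x} := by
    have hl : ∀ x, (↑u⁻¹ : H →L[ℂ] H) ((u : H →L[ℂ] H) x) = x := fun x =>
      DFunLike.congr_fun u.inv_mul x
    have hr : ∀ x, (u : H →L[ℂ] H) ((↑u⁻¹ : H →L[ℂ] H) x) = x := fun x =>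
      DFunLike.congr_fun u.mul_inv x
    have hqq : ∀ x, q (q x) = q x := fun x => DFunLike.congr_fun hq x
    ext y
    constructor
    · rintro ⟨x, rfl⟩
      simp [hd, hl, hqq]
    · intro hy
      refine ⟨(↑u⁻¹ : H →L[ℂ] H) ((↑u⁻¹ : H →L[ℂ] H) y), ?_⟩
      have hy : q ((↑u⁻¹ : H →L[ℂ] H) y) = (↑u⁻¹ : H →L[ℂ] H) y := hy
      simp [hd, hr, hy]
  rw [this]
  exact (isClosed_eq q.continuous continuous_id).preimage (ContinuousLinearMap.continuous _)

/-- Let `W t` be operators such that `W t s → 0` and `1 - W t` is a left multiple of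
the self-adjoint operator `s`. If `‖W t η‖²` converges to `⟪T η, η⟫`, then `T` is a projection. -/
theorem isStarProjection_of_tendsto {W : ℝ → H →L[ℂ] H} {s T : H →L[ℂ] H}
    (hs : IsSelfAdjoint s)
    (hWs : Tendsto (fun t => ‖W t * s‖) atTop (𝓝 0)) (hr : ∀ t, ∃ r, 1 - W t = r * s)
    (hT : ∀ η, Tendsto (fun t => ‖W t η‖ ^ 2) atTop (𝓝 (T.reApplyInnerSelf η)))
    (hTsa : IsSelfAdjoint T) : IsStarProjection T := by
  have hTpos : T.IsPositive :=
    ⟨hTsa.isSymmetric, fun η => ge_of_tendsto' (hT η) fun t => sq_nonneg _⟩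
  have hT0 : 0 ≤ T := (ContinuousLinearMap.nonneg_iff_isPositive _).2 hTpos
  -- The form of `T` vanishes on the range of `s` because `‖W t * s‖` tends to 0; hence the square
  -- root of `T` kills that range.
  have hTs : T * s = 0 := by
    have h1 : ∀ η, T.reApplyInnerSelf (s η) = 0 := by
      intro η
      refine tendsto_nhds_unique (hT (s η)) ?_
      have : Tendsto (fun t => (‖W t * s‖ * ‖η‖) ^ 2) atTop (𝓝 0) := by
        simpa using ((hWs.mul_const ‖η‖).pow 2)
      refine squeeze_zero (fun t => sq_nonneg _) (fun t => ?_) this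
      gcongr
      exact (W t * s).le_opNorm η
    set R := CFC.sqrt T with hR
    have hRsa : star R = R := (IsSelfAdjoint.of_nonneg (CFC.sqrt_nonneg T)).star_eq
    have hRR : R * R = T := CFC.sqrt_mul_sqrt_self T
    have hRs : R * s = 0 := by
      ext η
      have h2 : T.reApplyInnerSelf (s η) = ‖R (s η)‖ ^ 2 := by
        rw [ContinuousLinearMap.reApplyInnerSelf_apply, ← hRR]
        change RCLike.re (inner ℂ (R (R (s η))) (s η)) = _
        conv_lhs => rw [← hRsa, ContinuousLinearMap.star_eq_adjoint,
          ContinuousLinearMap.adjoint_inner_left]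
        rw [← ContinuousLinearMap.star_eq_adjoint, hRsa, inner_self_eq_norm_sq]
      rw [h1, eq_comm, sq_eq_zero_iff, norm_eq_zero] at h2
      exact h2
    rw [← hRR, mul_assoc, hRs, mul_zero]
  have hsT : s * T = 0 := by
    have := congrArg star hTs
    rwa [star_mul, hs.star_eq, hTsa.star_eq, star_zero] at this
  have hWT : ∀ t, W t * T = T := by
    intro t
    obtain ⟨r, hr⟩ := hr t
    rw [sub_eq_iff_eq_add, ← sub_eq_iff_eq_add'] at hr
    rw [← hr, sub_mul, mul_assoc, hsT]; simp
  -- `W t` fixes the range of `T`, so the limit form at `T x` is `‖T x‖²`: the quadratic forms of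
  -- `T³` and `T²` agree.
  have hcube : T * T * T = T * T := by
    have hsymm : ∀ x y, inner ℂ (T x) y = inner ℂ x (T y) := hTsa.isSymmetric
    refine ContinuousLinearMap.coe_injective ((ext_inner_map _ _).1 fun x => ?_)
    have h1 : T.reApplyInnerSelf (T x) = ‖T x‖ ^ 2 := by
      refine tendsto_nhds_unique (hT (T x)) ?_
      have h2 : ∀ t, W t (T x) = T x := fun t => DFunLike.congr_fun (hWT t) x
      simp only [h2]
      exact tendsto_const_nhds
    change inner ℂ (T (T (T x))) x = inner ℂ (T (T x)) x
    rw [hsymm (T (T x)), hsymm (T x) x, ← hTsa.isSymmetric.coe_reApplyInnerSelf_apply, h1,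
      inner_self_eq_norm_sq_to_K]
    norm_cast
  refine ⟨?_, hTsa⟩
  change T * T = T
  have hz : star (T * T - T) * (T * T - T) = 0 := by
    rw [star_sub, star_mul, hTsa.star_eq, mul_sub, sub_mul, sub_mul, ← mul_assoc, hcube, hcube,
      sub_self, ← mul_assoc, hcube, sub_self, sub_self]
  exact sub_eq_zero.1 (CStarRing.star_mul_self_eq_zero_iff _ |>.1 hz)

end LimitPoint
end OperatorDisk

namespace OperatorDisk
open Filter Topology

/-! ### Matrices preserving the form, and their first column -/

section Disk

variable {A : Type*} [CStarAlgebra A]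

/-- The matrix of the form `θ`. -/
def signature : Matrix (Fin 2) (Fin 2) A := !![1, 0; 0, -1]

theorem signature_mul_signature : (signature * signature : Matrix (Fin 2) (Fin 2) A) = 1 := by
  ext i j
  fin_cases i <;> fin_cases j <;> simp [signature, Matrix.mul_apply]

open Matrix in
theorem theta_eq (x y : Fin 2 → A) : theta x y = star x ⬝ᵥ (signature *ᵥ y) := by
  simp [theta, signature, dotProduct, Matrix.mulVec, Fin.sum_univ_two, sub_eq_add_neg]

open Matrix in
theorem conjTranspose_mul_signature_mul {g : Matrix (Fin 2) (Fin 2) A}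
    (hg : ∀ x y, theta (g *ᵥ x) (g *ᵥ y) = theta x y) : gᴴ * signature * g = signature := by
  have key : ∀ (N : Matrix (Fin 2) (Fin 2) A) (i j : Fin 2),
      star (Pi.single i 1 : Fin 2 → A) ⬝ᵥ (N *ᵥ (Pi.single j 1)) = N i j := by
    intro N i j
    rw [← Pi.single_star, star_one, Matrix.mulVec_single_one, single_one_dotProduct]; rfl
  ext i j
  rw [← key (gᴴ * signature * g), ← key signature]
  have h := hg (Pi.single i 1) (Pi.single j 1)
  rw [theta_eq, theta_eq, Matrix.star_mulVec] at h
  rw [← h, ← Matrix.dotProduct_mulVec, Matrix.mulVec_mulVec, Matrix.mulVec_mulVec, mul_assoc]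

/-- The matrices which preserve the form of signature `(1, -1)`, together with their adjoints. -/
structure IsPseudoUnitary (N : Matrix (Fin 2) (Fin 2) A) : Prop where
  left : N.conjTranspose * signature * N = signature
  right : N * signature * N.conjTranspose = signature

open Matrix in
-- With `J` the signature, `N* J N = J` makes `J N* J` a left inverse of the invertible `N`, hence
-- its inverse; this yields the identity for rows.
theorem IsPseudoUnitary.of_mem {g : (Matrix (Fin 2) (Fin 2) A)ˣ} (hg : g ∈ thetaUnitary A) :
    IsPseudoUnitary (g : Matrix (Fin 2) (Fin 2) A) := by
  obtain ⟨N, N', hNN', hN'N⟩ := g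
  change IsPseudoUnitary N
  have h : Nᴴ * signature * N = signature := conjTranspose_mul_signature_mul hg
  refine ⟨h, ?_⟩
  have h1 : (signature * Nᴴ * signature) * N = 1 := by
    rw [mul_assoc, mul_assoc, ← mul_assoc Nᴴ, h, signature_mul_signature]
  have h2 : N * (signature * Nᴴ * signature) = 1 := by
    rw [left_inv_eq_right_inv h1 hNN', hNN']
  calc N * signature * Nᴴ = N * (signature * Nᴴ * signature) * signature := by
        simp only [mul_assoc, signature_mul_signature, mul_one]
    _ = signature := by rw [h2, one_mul]

theorem IsPseudoUnitary.mul {M N : Matrix (Fin 2) (Fin 2) A} (hM : IsPseudoUnitary M)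
    (hN : IsPseudoUnitary N) : IsPseudoUnitary (M * N) := by
  constructor
  · calc _ = N.conjTranspose * (M.conjTranspose * signature * M) * N := by
          simp only [Matrix.conjTranspose_mul, mul_assoc]
      _ = signature := by rw [hM.left, hN.left]
  · calc _ = M * (N * signature * N.conjTranspose) * M.conjTranspose := by
          simp only [Matrix.conjTranspose_mul, mul_assoc]
      _ = signature := by rw [hN.right, hM.right]

theorem IsPseudoUnitary.column {N : Matrix (Fin 2) (Fin 2) A} (hN : IsPseudoUnitary N) :
    star (N 0 0) * N 0 0 - star (N 1 0) * N 1 0 = 1 := by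
  have := congrFun (congrFun hN.left 0) 0
  simpa [signature, Matrix.mul_apply, Fin.sum_univ_two, ← sub_eq_add_neg] using this

theorem IsPseudoUnitary.row {N : Matrix (Fin 2) (Fin 2) A} (hN : IsPseudoUnitary N) :
    N 0 0 * star (N 0 0) - N 0 1 * star (N 0 1) = 1 := by
  have := congrFun (congrFun hN.right 0) 0
  simpa [signature, Matrix.mul_apply, Fin.sum_univ_two, ← sub_eq_add_neg] using this

variable [PartialOrder A] [StarOrderedRing A]

/-- Both `x* x` and `x x*` dominate 1, which gives a left and a right inverse. -/
theorem isUnit_of_star_mul_self_sub {x y u : A} (h : star x * x - star y * y = 1)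
    (h' : x * star x - u * star u = 1) : IsUnit x := by
  have h1 : IsUnit (star x * x) := by
    refine CStarAlgebra.isUnit_of_le 1 ?_ 
    rw [← sub_nonneg, ← h]; simp [star_mul_self_nonneg]
  have h2 : IsUnit (x * star x) := by
    refine CStarAlgebra.isUnit_of_le 1 ?_
    rw [← sub_nonneg, ← h']; simp [mul_star_self_nonneg]
  obtain ⟨a, ha⟩ := h1
  obtain ⟨b, hb⟩ := h2
  refine isUnit_iff_exists_and_exists.2 ⟨⟨star x * ↑b⁻¹, ?_⟩, ⟨↑a⁻¹ * star x, ?_⟩⟩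
  · rw [← mul_assoc, ← hb, Units.mul_inv]
  · rw [mul_assoc, ← ha, Units.inv_mul]

theorem IsPseudoUnitary.isUnit {N : Matrix (Fin 2) (Fin 2) A} (hN : IsPseudoUnitary N) :
    IsUnit (N 0 0) :=
  isUnit_of_star_mul_self_sub hN.column hN.row

/-- The norm of the positive element `u* u` lies in its spectrum, so norm 1 would contradict
invertibility. -/
theorem norm_lt_one_of_isUnit {u : A} (h0 : 0 ≤ 1 - star u * u) (h : IsUnit (1 - star u * u)) :
    ‖u‖ < 1 := by
  nontriviality A
  have hpos : 0 ≤ star u * u := star_mul_self_nonneg u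
  have h1 : ‖star u * u‖ ≤ 1 := by
    rw [CStarAlgebra.norm_le_one_iff_of_nonneg _ hpos]
    exact sub_nonneg.1 h0
  have h2 : ‖star u * u‖ ≠ 1 := by
    intro h2
    have := CStarAlgebra.norm_mem_spectrum_of_nonneg hpos
    rw [h2, spectrum.mem_iff, map_one] at this
    exact this h
  have h3 := lt_of_le_of_ne h1 h2
  rw [CStarRing.norm_star_mul_self] at h3
  nlinarith [norm_nonneg u]

omit [PartialOrder A] [StarOrderedRing A] in
-- This is the column identity multiplied by `(x⁻¹)*` and `x⁻¹`; it computes the defect of the point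
-- `N · 0`.
theorem IsPseudoUnitary.one_sub_star_mul_self {N : Matrix (Fin 2) (Fin 2) A}
    (hN : IsPseudoUnitary N) {x : Aˣ} (hx : (x : A) = N 0 0) :
    1 - star (N 1 0 * ↑x⁻¹) * (N 1 0 * ↑x⁻¹) = star (↑x⁻¹ : A) * ↑x⁻¹ := by
  have h1 := hN.column
  rw [← hx] at h1
  have h2 : star (↑x⁻¹ : A) * star (x : A) = 1 := by rw [← star_mul, Units.mul_inv, star_one]
  calc 1 - star (N 1 0 * ↑x⁻¹) * (N 1 0 * ↑x⁻¹)
      = (star (↑x⁻¹ : A) * star (x : A)) * (x * ↑x⁻¹) -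
        star (↑x⁻¹ : A) * (star (N 1 0) * N 1 0) * ↑x⁻¹ := by
        rw [h2, Units.mul_inv]; simp [mul_assoc]
    _ = star (↑x⁻¹ : A) * (star (x : A) * x - star (N 1 0) * N 1 0) * ↑x⁻¹ := by noncomm_ring
    _ = _ := by rw [h1, mul_one]

theorem IsPseudoUnitary.norm_lt_one {N : Matrix (Fin 2) (Fin 2) A} (hN : IsPseudoUnitary N)
    {x : Aˣ} (hx : (x : A) = N 0 0) : ‖N 1 0 * ↑x⁻¹‖ < 1 := by
  apply norm_lt_one_of_isUnit
  · rw [hN.one_sub_star_mul_self hx]; exact star_mul_self_nonneg _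
  · rw [hN.one_sub_star_mul_self hx]; exact (x⁻¹).isUnit.star.mul (x⁻¹).isUnit

end Disk
end OperatorDisk

namespace OperatorDisk
open Filter Topology

/-! ### The exponential of the generator and the hyperbolic cosine -/

section Exponential

variable {A : Type*} [CStarAlgebra A]

open scoped Matrix.Norms.Operator Nat in
theorem hasSum_matrix_exp_apply (X : Matrix (Fin 2) (Fin 2) A) (i j : Fin 2) :
    HasSum (fun n : ℕ => ((n ! : ℝ)⁻¹) • (X ^ n) i j) (NormedSpace.exp X i j) := by
  let : NormedAlgebra ℝ A := NormedAlgebra.restrictScalars ℝ ℂ A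
  have : CompleteSpace (Matrix (Fin 2) (Fin 2) A) :=
    inferInstanceAs (CompleteSpace (Fin 2 → Fin 2 → A))
  have h :=
    @NormedSpace.exp_series_hasSum_exp' ℝ (Matrix (Fin 2) (Fin 2) A) _ _ _ _ _ (by exact this) X
  exact (Pi.hasSum.1 (Pi.hasSum.1 h i) j)

theorem signature_mul_exp_mul (X : Matrix (Fin 2) (Fin 2) A) (hX : signature * X * signature = -X) :
    signature * NormedSpace.exp X * signature = NormedSpace.exp (-X) := by
  let : NormedAlgebra ℚ A := NormedAlgebra.restrictScalars ℚ ℂ A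
  let J : (Matrix (Fin 2) (Fin 2) A)ˣ :=
    ⟨signature, signature, signature_mul_signature, signature_mul_signature⟩
  rw [← hX]
  exact (Matrix.exp_units_conj J X).symm

/-- The exponential is Hermitian, and conjugation by the signature inverts it. -/
theorem isPseudoUnitary_exp (X : Matrix (Fin 2) (Fin 2) A) (hX : signature * X * signature = -X)
    (hsa : X.IsHermitian) : IsPseudoUnitary (NormedSpace.exp X) := by
  let : NormedAlgebra ℚ A := NormedAlgebra.restrictScalars ℚ ℂ A
  have h1 := signature_mul_exp_mul X hX
  have h2 : NormedSpace.exp (-X) * NormedSpace.exp X = 1 := by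
    rw [← Matrix.exp_add_of_commute _ _ (Commute.neg_left (Commute.refl X)), neg_add_cancel,
      NormedSpace.exp_zero]
  have h3 : NormedSpace.exp X * signature * NormedSpace.exp X = signature := by
    calc _ = signature * (signature * NormedSpace.exp X * signature * NormedSpace.exp X) := by
          simp only [← mul_assoc, signature_mul_signature, one_mul]
      _ = signature := by rw [h1, h2, mul_one]
  have h4 := hsa.exp
  exact ⟨by rw [h4.eq, h3], by rw [h4.eq, h3]⟩

/-- The generator of the geodesics which start at `0`. -/
def generator (α : A) : Matrix (Fin 2) (Fin 2) A := !![0, star α; α, 0]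

theorem signature_mul_generator (α : A) (t : ℝ) :
    signature * (t • generator α) * signature = -(t • generator α) := by
  ext i j
  fin_cases i <;> fin_cases j <;> simp [signature, generator, Matrix.mul_apply]

theorem isHermitian_generator (α : A) (t : ℝ) : (t • generator α).IsHermitian := by
  ext i j
  fin_cases i <;> fin_cases j <;> simp [generator]

/-- The square of the generator is diagonal, so the entry is `s ^ n` for even `n` and 0 for odd `n`.
The average covers both cases and matches the series of `(exp s + exp (-s)) / 2`. -/
theorem generator_pow_apply (α s : A) (hs : s * s = star α * α) (n : ℕ) :
    (generator α ^ n) 0 0 = (2 : ℝ)⁻¹ • (s ^ n + (-s) ^ n) := by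
  induction n using Nat.twoStepInduction with
  | zero => simp [← two_smul ℝ (1 : A), smul_smul]
  | one => simp [generator]
  | more n h _ =>
    have hsq : generator α * generator α = !![star α * α, 0; 0, α * star α] := by
      ext i j
      fin_cases i <;> fin_cases j <;> simp [generator, Matrix.mul_apply]
    have hX : generator α ^ (n + 2) = !![star α * α, 0; 0, α * star α] * generator α ^ n := by
      rw [← hsq, add_comm, pow_add, sq]
    rw [hX]
    simp only [Matrix.mul_apply, Fin.sum_univ_two, h]
    simp [← hs, pow_succ', mul_assoc, mul_add]

variable [PartialOrder A] [StarOrderedRing A]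

omit [PartialOrder A] [StarOrderedRing A] in
theorem exp_generator_apply_zero (α s : A) (hsa : IsSelfAdjoint s) (hs : s * s = star α * α)
    (t : ℝ) : NormedSpace.exp (t • generator α) 0 0 = cfc (fun x => Real.cosh (t * x)) s := by
  let : NormedAlgebra ℚ A := NormedAlgebra.restrictScalars ℚ ℂ A
  have h1 := hasSum_matrix_exp_apply (t • generator α) 0 0
  have h2 : ∀ r : ℝ, HasSum (fun n : ℕ => ((n.factorial : ℝ)⁻¹) • (r • s) ^ n)
      (cfc (fun x => Real.exp (r * x)) s) := by
    intro r
    have hrs : IsSelfAdjoint (r • s) := IsSelfAdjoint.smul (IsSelfAdjoint.all r) hsa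
    have h3 : cfc (fun x => Real.exp (r * x)) s = NormedSpace.exp (r • s) := by
      rw [← CFC.real_exp_eq_normedSpace_exp hrs, ← cfc_comp_const_mul r Real.exp s]
    rw [h3]
    exact NormedSpace.exp_series_hasSum_exp' (𝕂 := ℝ) (r • s)
  have h3 := ((h2 t).add (h2 (-t))).const_smul (2 : ℝ)⁻¹
  refine h1.unique ?_
  have h4 : cfc (fun x => Real.cosh (t * x)) s = (2 : ℝ)⁻¹ •
      (cfc (fun x => Real.exp (t * x)) s + cfc (fun x => Real.exp (-t * x)) s) := by
    rw [← cfc_add .., ← cfc_smul ..]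
    congr 1
    ext x
    rw [Real.cosh_eq, smul_eq_mul, neg_mul]; ring
  rw [h4]
  convert h3 using 2 with n
  rw [smul_pow, Matrix.smul_apply, generator_pow_apply α s hs, neg_smul, ← smul_neg, smul_pow,
    smul_pow, smul_comm _ (2 : ℝ)⁻¹, smul_comm _ (2 : ℝ)⁻¹, smul_add, smul_add]

/-- The functional calculus facts on `w = 1 / cosh (t s)`. -/
theorem exists_inverse_cosh (s : A) (hs : 0 ≤ s) (t : ℝ) :
    ∃ w : A, w * cfc (fun x => Real.cosh (t * x)) s = 1 ∧ ‖w‖ ≤ 1 ∧ |t| * ‖w * s‖ ≤ 1 ∧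
      ∃ r, 1 - w = r * s := by
  have hsa : IsSelfAdjoint s := IsSelfAdjoint.of_nonneg hs
  have hne : ∀ x : ℝ, Real.cosh (t * x) ≠ 0 := fun x => (Real.cosh_pos _).ne'
  have hcont : Continuous fun x : ℝ => (Real.cosh (t * x))⁻¹ :=
    (by fun_prop : Continuous fun x : ℝ => Real.cosh (t * x)).inv₀ hne
  have hcosh : ∀ x : ℝ, |x| ≤ Real.cosh x := by
    intro x
    rw [← Real.cosh_abs]
    exact (Real.self_le_sinh_iff.2 (abs_nonneg x)).trans (Real.sinh_lt_cosh _).le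
  refine ⟨cfc (fun x => (Real.cosh (t * x))⁻¹) s, ?_, ?_, ?_, ?_⟩
  · rw [← cfc_mul _ _ s hcont.continuousOn]
    simp only [inv_mul_cancel₀ (hne _)]
    exact cfc_const_one ℝ s
  · refine norm_cfc_le zero_le_one fun x _ => ?_
    rw [Real.norm_of_nonneg (inv_nonneg.2 (Real.cosh_pos _).le)]
    exact inv_le_one_of_one_le₀ (Real.one_le_cosh _)
  -- The function `t x / cosh (t x)` is bounded by 1 because `|u| ≤ cosh u`.
  · have : t • (cfc (fun x => (Real.cosh (t * x))⁻¹) s * s) =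
        cfc (fun x => (Real.cosh (t * x))⁻¹ * (t * x)) s := by
      rw [cfc_mul _ _ s hcont.continuousOn, cfc_const_mul t (fun x => x) s, cfc_id' ℝ s,
        mul_smul_comm]
    rw [← Real.norm_eq_abs, ← norm_smul, this]
    refine norm_cfc_le zero_le_one fun x _ => ?_
    rw [norm_mul, norm_inv, Real.norm_of_nonneg (Real.cosh_pos _).le,
      inv_mul_le_one₀ (Real.cosh_pos _)]
    exact hcosh _
  -- Since `f 0 = 1`, the function `1 - f` is divisible by `x`; `dslope` supplies a quotient
  -- continuous at 0.
  · let f : ℝ → ℝ := fun x => (Real.cosh (t * x))⁻¹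
    have hd : Differentiable ℝ f := by
      intro x
      exact DifferentiableAt.inv (by fun_prop) (hne x)
    have hds : Continuous (dslope f 0) := by
      rw [← continuousOn_univ, continuousOn_dslope univ_mem]
      exact ⟨hcont.continuousOn, hd 0⟩
    refine ⟨cfc (fun x => -dslope f 0 x) s, ?_⟩
    have h1 : ∀ x, 1 - f x = -dslope f 0 x * x := by
      intro x
      have := sub_smul_dslope f 0 x
      simp only [sub_zero, smul_eq_mul] at this
      have h0 : f 0 = 1 := by simp [f]
      rw [h0] at this
      linarith
    calc 1 - cfc f s = cfc (fun x => 1 - f x) s := by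
          rw [cfc_sub (fun _ => 1) f s (hg := hcont.continuousOn), cfc_const_one ℝ s]
      _ = cfc (fun x => -dslope f 0 x) s * cfc (fun x => x) s := by
          simp only [h1]
          exact cfc_mul _ _ s hds.neg.continuousOn
      _ = _ := by rw [cfc_id' ℝ s]

end Exponential
end OperatorDisk

namespace OperatorDisk
open Filter Topology

/-! ### The defect along a geodesic -/

section Geodesic

variable {A : Type*} [CStarAlgebra A] [PartialOrder A] [StarOrderedRing A]

/-- The defect of a geodesic `δ` factors through the inverse of `cosh (t s)`. -/
theorem IsGeodesic.exists_factorization {δ : ℝ → A} (hδ : IsGeodesic δ) :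
    ∃ (p : Aˣ) (q s : A), ‖(↑p⁻¹ : A) * q‖ < 1 ∧ 0 ≤ s ∧ ∀ t, ∃ w : A,
      ‖w‖ ≤ 1 ∧ |t| * ‖w * s‖ ≤ 1 ∧ (∃ r, 1 - w = r * s) ∧
      star (w * (p - q * δ t)) * (w * (p - q * δ t)) = 1 - star (δ t) * δ t := by
  obtain ⟨g, hg, α, hδ⟩ := hδ
  set N : Matrix (Fin 2) (Fin 2) A := (g : Matrix (Fin 2) (Fin 2) A) with hNdef
  have hN : IsPseudoUnitary N := IsPseudoUnitary.of_mem hg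
  obtain ⟨y, hy⟩ := hN.isUnit
  set s : A := CFC.sqrt (star α * α) with hs
  have hs0 : 0 ≤ s := CFC.sqrt_nonneg _
  have hss : s * s = star α * α := CFC.sqrt_mul_sqrt_self _ (star_mul_self_nonneg α)
  refine ⟨star y, star (N 1 0), s, ?_, hs0, fun t => ?_⟩
  · rw [← star_inv, Units.coe_star, ← star_mul, norm_star]
    exact hN.norm_lt_one hy
  obtain ⟨w, hw, hw1, hws, hr⟩ := exists_inverse_cosh s hs0 t
  refine ⟨w, hw1, hws, hr, ?_⟩
  set E : Matrix (Fin 2) (Fin 2) A := NormedSpace.exp (t • generator α) with hE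
  have hEp : IsPseudoUnitary E :=
    isPseudoUnitary_exp _ (signature_mul_generator α t) (isHermitian_generator α t)
  rw [← exp_generator_apply_zero α s (IsSelfAdjoint.of_nonneg hs0) hss t, ← hE] at hw
  have hG := hN.mul hEp
  obtain ⟨e, he⟩ := hEp.isUnit
  obtain ⟨x, hx⟩ := hG.isUnit
  have hδt : δ t = (N * E) 1 0 * ↑x⁻¹ := by
    have hz : geodesicFromZero α t = E 1 0 * ↑e⁻¹ := by
      change (E 1 0 + E 1 1 * 0) * Ring.inverse (E 0 0 + E 0 1 * 0) = _
      rw [mul_zero, mul_zero, add_zero, add_zero, ← he, Ring.inverse_unit]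
    have h0 : N 0 0 + N 0 1 * (E 1 0 * ↑e⁻¹) = ((x * e⁻¹ : Aˣ) : A) := by
      rw [Units.val_mul, hx, Matrix.mul_apply, Fin.sum_univ_two, ← he, add_mul, mul_assoc _ (e : A),
        Units.mul_inv, mul_one, mul_assoc]
    have h1 : N 1 0 + N 1 1 * (E 1 0 * ↑e⁻¹) = (N * E) 1 0 * ↑e⁻¹ := by
      rw [Matrix.mul_apply, Fin.sum_univ_two, ← he, add_mul, mul_assoc _ (e : A),
        Units.mul_inv, mul_one, mul_assoc]
    rw [hδ, hz, mobius, h0, h1, Ring.inverse_unit, mul_inv_rev, inv_inv, Units.val_mul, mul_assoc,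
      ← mul_assoc (↑e⁻¹ : A), Units.inv_mul, one_mul]
  -- With `J` the signature, this is the upper left entry of `N* J (N E) = J E`, multiplied by `x⁻¹`
  -- on the right.
  have hp : star (y : A) - star (N 1 0) * δ t = e * ↑x⁻¹ := by
    have h1 : star (N 0 0) * (N * E) 0 0 - star (N 1 0) * (N * E) 1 0 = E 0 0 := by
      have h2 : N.conjTranspose * signature * (N * E) = signature * E := by
        rw [← mul_assoc, hN.left]
      have := congrFun (congrFun h2 0) 0
      simpa [signature, Matrix.mul_apply, Fin.sum_univ_two, ← sub_eq_add_neg] using this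
    rw [hδt, he, ← h1, sub_mul, ← hx, mul_assoc _ (x : A), Units.mul_inv, mul_one, mul_assoc, hy]
  have hwp : w * (star (y : A) - star (N 1 0) * δ t) = ↑x⁻¹ := by
    rw [hp, ← mul_assoc, he, hw, one_mul]
  rw [Units.coe_star, hwp, hδt, hG.one_sub_star_mul_self hx]

end Geodesic

/-! ### The defect of a limit point -/

section LimitPoint

variable {H : Type*} [NormedAddCommGroup H] [InnerProductSpace ℂ H] [CompleteSpace H]

theorem reApplyInnerSelf_star_mul_self (B : H →L[ℂ] H) (ξ : H) :
    (star B * B).reApplyInnerSelf ξ = ‖B ξ‖ ^ 2 := by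
  rw [ContinuousLinearMap.reApplyInnerSelf_apply]
  change RCLike.re (inner ℂ (star B (B ξ)) ξ) = _
  rw [ContinuousLinearMap.star_eq_adjoint, ContinuousLinearMap.adjoint_inner_left,
    inner_self_eq_norm_sq]

theorem reApplyInnerSelf_one_sub (B : H →L[ℂ] H) (ξ : H) :
    (1 - star B * B).reApplyInnerSelf ξ = ‖ξ‖ ^ 2 - ‖B ξ‖ ^ 2 := by
  rw [← reApplyInnerSelf_star_mul_self, ContinuousLinearMap.reApplyInnerSelf_apply,
    ContinuousLinearMap.reApplyInnerSelf_apply, sub_apply, inner_sub_left,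
    map_sub, ← inner_self_eq_norm_sq (𝕜 := ℂ)]
  rfl

theorem reApplyInnerSelf_conj (B R : H →L[ℂ] H) (ξ : H) :
    (star R * B * R).reApplyInnerSelf ξ = B.reApplyInnerSelf (R ξ) := by
  rw [ContinuousLinearMap.reApplyInnerSelf_apply, ContinuousLinearMap.reApplyInnerSelf_apply]
  change RCLike.re (inner ℂ (star R (B (R ξ))) ξ) = _
  rw [ContinuousLinearMap.star_eq_adjoint, ContinuousLinearMap.adjoint_inner_left]

variable {A : Type*} [CStarAlgebra A] [PartialOrder A] [StarOrderedRing A]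

/-- Products and adjoints are awkward under strong limits, so the factorization is passed to the
limit through the scalars `‖ξ‖² - ‖δ ξ‖²`. -/
theorem IsGeodesic.exists_defect_eq (S : VonNeumannAlgebra H) (π : A →⋆ₐ[ℂ] (H →L[ℂ] H))
    (hπ : ∀ a, π a ∈ S) {δ : ℝ → A} (hδ : IsGeodesic δ) {a : H →L[ℂ] H} (ha : a ∈ S)
    (hlim : ∀ ξ, Tendsto (fun t => π (δ t) ξ) atTop (𝓝 (a ξ))) :
    ∃ T ∈ S, IsStarProjection T ∧ ∃ M : (H →L[ℂ] H)ˣ, (M : H →L[ℂ] H) ∈ S ∧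
      1 - star a * a = star (M : H →L[ℂ] H) * T * M := by
  obtain ⟨p, q, s, hpq, hs, hw⟩ := hδ.exists_factorization
  choose w hw1 hws hr hdef using hw
  have hπn : ∀ x, ‖π x‖ ≤ ‖x‖ := fun x => NonUnitalStarAlgHom.norm_apply_le π x
  have hdef' : ∀ t ξ, ‖π (w t) ((π p - π q * π (δ t)) ξ)‖ ^ 2 = ‖ξ‖ ^ 2 - ‖π (δ t) ξ‖ ^ 2 := by
    intro t ξ
    have h := congrArg π (hdef t)
    simp only [map_mul, map_star, map_sub, map_one] at h
    rw [← reApplyInnerSelf_one_sub, ← h, reApplyInnerSelf_star_mul_self]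
    rfl
  have hlimsq : ∀ ξ, Tendsto (fun t => ‖ξ‖ ^ 2 - ‖π (δ t) ξ‖ ^ 2) atTop
      (𝓝 (‖ξ‖ ^ 2 - ‖a ξ‖ ^ 2)) := fun ξ => ((hlim ξ).norm.pow 2).const_sub _
  have hnn : ∀ ξ, 0 ≤ ‖ξ‖ ^ 2 - ‖a ξ‖ ^ 2 := fun ξ =>
    ge_of_tendsto' (hlimsq ξ) fun t => by rw [← hdef']; positivity
  have ha1 : ‖a‖ ≤ 1 := by
    refine ContinuousLinearMap.opNorm_le_bound _ zero_le_one fun ξ => ?_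
    rw [one_mul]
    exact le_of_sq_le_sq (sub_nonneg.1 (hnn ξ)) (norm_nonneg _)
  set M₀ : H →L[ℂ] H := π p - π q * a with hM₀
  have hM₀S : M₀ ∈ S := sub_mem (hπ _) (mul_mem (hπ _) ha)
  obtain ⟨M, hM⟩ : IsUnit M₀ := by
    have h1 : ‖π (↑p⁻¹ * q) * a‖ < 1 := by
      calc _ ≤ ‖π (↑p⁻¹ * q)‖ * ‖a‖ := norm_mul_le _ _
        _ ≤ ‖(↑p⁻¹ : A) * q‖ * 1 := by gcongr; exact hπn _
        _ < 1 := by rwa [mul_one]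
    have h2 : M₀ = π p * (1 - π (↑p⁻¹ * q) * a) := by
      rw [mul_sub, mul_one, ← mul_assoc, ← map_mul, Units.mul_inv_cancel_left]
    rw [h2]
    exact (p.isUnit.map π).mul (isUnit_one_sub_of_norm_lt_one h1)
  have hMS : (M : H →L[ℂ] H) ∈ S := hM ▸ hM₀S
  have hMiS := inverse_mem_vonNeumann S hMS
  set R : H →L[ℂ] H := ↑M⁻¹ with hR
  have hMR : ∀ η, M₀ (R η) = η := fun η => hM ▸ DFunLike.congr_fun M.mul_inv η
  have hWlim : ∀ ξ, Tendsto (fun t => ‖π (w t) (M₀ ξ)‖ ^ 2) atTop (𝓝 (‖ξ‖ ^ 2 - ‖a ξ‖ ^ 2)) := by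
    intro ξ
    have h1 : Tendsto (fun t => ‖π (w t) ((π p - π q * π (δ t)) ξ)‖) atTop
        (𝓝 (√(‖ξ‖ ^ 2 - ‖a ξ‖ ^ 2))) := by
      have := (hlimsq ξ).sqrt
      simp only [← hdef', Real.sqrt_sq (norm_nonneg _)] at this
      exact this
    have h2 : Tendsto (fun t => ‖(π p - π q * π (δ t)) ξ - M₀ ξ‖) atTop (𝓝 0) := by
      have h3 : Tendsto (fun t => π p ξ - π q (π (δ t) ξ)) atTop (𝓝 (π p ξ - π q (a ξ))) :=
        (((π q).continuous.tendsto _).comp (hlim ξ)).const_sub _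
      exact tendsto_iff_norm_sub_tendsto_zero.1 h3
    -- No convergence of `w t` is needed: as a contraction it does not enlarge the error from
    -- replacing `δ t` by `a`.
    have h4 : Tendsto (fun t => ‖π (w t) (M₀ ξ)‖ - ‖π (w t) ((π p - π q * π (δ t)) ξ)‖) atTop
        (𝓝 0) := by
      refine squeeze_zero_norm (fun t => ?_) h2
      rw [Real.norm_eq_abs, abs_sub_comm]
      refine (abs_norm_sub_norm_le _ _).trans ?_
      rw [← map_sub]
      exact ((π (w t)).le_opNorm _).trans
        (mul_le_of_le_one_left (norm_nonneg _) ((hπn _).trans (hw1 t)))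
    have h5 := (h4.add h1).pow 2
    simp only [sub_add_cancel, zero_add, Real.sq_sqrt (hnn ξ)] at h5
    exact h5
  set T : H →L[ℂ] H := star R * (1 - star a * a) * R with hT
  have hTS : T ∈ S := mul_mem (mul_mem (star_mem hMiS)
    (sub_mem (one_mem S) (mul_mem (star_mem ha) ha))) hMiS
  have hTsa : IsSelfAdjoint T := by
    simp [IsSelfAdjoint, hT, mul_assoc]
  refine ⟨T, hTS, ?_, M, hMS, ?_⟩
  · refine isStarProjection_of_tendsto (W := fun t => π (w t)) (s := π s)
      ((IsSelfAdjoint.of_nonneg hs).map π) ?_ ?_ ?_ hTsa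
    · refine squeeze_zero' (Eventually.of_forall fun t => norm_nonneg _) ?_ tendsto_inv_atTop_zero
      filter_upwards [eventually_gt_atTop 0] with t ht
      rw [← map_mul]
      refine (hπn _).trans ?_
      rw [← one_div, le_div_iff₀' ht]
      simpa [abs_of_pos ht] using hws t
    · intro t
      obtain ⟨r, hr⟩ := hr t
      exact ⟨π r, by rw [← map_one π, ← map_sub, hr, map_mul]⟩
    · intro η
      rw [hT, reApplyInnerSelf_conj, reApplyInnerSelf_one_sub]
      have := hWlim (R η)
      rwa [hMR] at this
  · have h1 : R * M = 1 := M.inv_mul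
    have h2 : star (M : H →L[ℂ] H) * star R = 1 := by rw [← star_mul, h1, star_one]
    calc _ = (star (M : H →L[ℂ] H) * star R) * (1 - star a * a) * (R * M) := by
          rw [h1, h2, one_mul, mul_one]
      _ = _ := by simp only [hT, mul_assoc]

theorem defect_of_isGeodesic (S : VonNeumannAlgebra H) (π : A →⋆ₐ[ℂ] (H →L[ℂ] H))
    (hπ : ∀ a, π a ∈ S) {δ : ℝ → A} (hδ : IsGeodesic δ) (a : S)
    (hlim : ∀ ξ, Tendsto (fun t => π (δ t) ξ) atTop (𝓝 ((a : H →L[ℂ] H) ξ))) :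
    (∃ h q : S, (h : H →L[ℂ] H).IsPositive ∧ IsUnit h ∧ IsStarProjection q ∧
      1 - star a * a = h * q * h) ∧
    IsClosed (Set.range ((1 - star a * a : S) : H →L[ℂ] H)) := by
  obtain ⟨T, hTS, hT, M, hMS, hdef⟩ := hδ.exists_defect_eq S π hπ a.2 hlim
  obtain ⟨h, q, hh, hu, hq, heq⟩ := exists_positive_mul_projection_mul S hTS hT M hMS
  have hval : 1 - star (a : H →L[ℂ] H) * a = h * q * h := hdef.trans heq
  refine ⟨⟨h, q, hh, hu, hq, Subtype.ext hval⟩, ?_⟩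
  exact isClosed_range_of_eq_mul_projection_mul (h := (h : H →L[ℂ] H)) (q := q)
    (hu.map (SubringClass.subtype S)) (congrArg Subtype.val hq.isIdempotentElem) hval

end LimitPoint
end OperatorDisk

namespace OperatorDisk
open Filter Topology
open scoped ComplexOrder

/-! ### States and eigenvectors in the universal representation -/

section States
universe u
variable {A : Type u} [CStarAlgebra A] [PartialOrder A] [StarOrderedRing A]

/-- The self-adjoint elements which are bounded below by a positive multiple of `1`. -/
def strictlyPositiveCone (A : Type u) [CStarAlgebra A] [PartialOrder A] : Set (selfAdjoint A) :=
  {x | ∃ ε : ℝ, 0 < ε ∧ algebraMap ℝ A ε ≤ x}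

theorem isOpen_strictlyPositiveCone : IsOpen (strictlyPositiveCone A) := by
  rw [Metric.isOpen_iff]
  rintro x ⟨ε, hε, hx⟩
  refine ⟨ε / 2, half_pos hε, fun y hy => ⟨ε / 2, half_pos hε, ?_⟩⟩
  have h1 : (x - y : A) ≤ algebraMap ℝ A (ε / 2) := by
    refine (IsSelfAdjoint.le_algebraMap_norm_self (x - y).2).trans ?_
    refine algebraMap_mono A ?_
    rw [Metric.mem_ball, dist_comm, dist_eq_norm] at hy
    exact hy.le
  have h2 : algebraMap ℝ A (ε / 2) + algebraMap ℝ A (ε / 2) ≤ x := by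
    rwa [← map_add, add_halves]
  calc algebraMap ℝ A (ε / 2) ≤ x - algebraMap ℝ A (ε / 2) := le_sub_iff_add_le.2 h2
    _ ≤ x - (x - y) := sub_le_sub_left h1 _
    _ = y := by abel

theorem convex_strictlyPositiveCone : Convex ℝ (strictlyPositiveCone A) := by
  rintro x ⟨ε, hε, hx⟩ y ⟨ε', hε', hy⟩ a b ha hb hab
  refine ⟨a * ε + b * ε', ?_, ?_⟩
  · rcases ha.eq_or_lt with rfl | ha
    · rw [zero_add] at hab
      simpa [hab] using hε'
    · positivity
  · rw [map_add, map_mul, map_mul, ← Algebra.smul_def, ← Algebra.smul_def]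
    exact add_le_add (smul_le_smul_of_nonneg_left hx ha) (smul_le_smul_of_nonneg_left hy hb)

/-- A positive element which is not invertible is annihilated by some state. -/
theorem exists_state_apply_eq_zero {y : A} (hy : 0 ≤ y) (hyu : ¬ IsUnit y) :
    ∃ f : State A, f.1 y = 0 := by
  have hysa : IsSelfAdjoint y := IsSelfAdjoint.of_nonneg hy
  let y' : selfAdjoint A := ⟨y, hysa⟩
  have hyU : y' ∉ strictlyPositiveCone A := by
    rintro ⟨ε, hε, h⟩
    refine hyu (CStarAlgebra.isUnit_of_le (algebraMap ℝ A ε) h ?_)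
    exact (hε.ne'.isUnit.map (algebraMap ℝ A)).isStrictlyPositive (algebraMap_nonneg A hε.le)
  -- The separating functional is nonpositive on positive elements; dividing by `φ 1 < 0` restores
  -- positivity and normalizes it.
  obtain ⟨φ, hφ⟩ := geometric_hahn_banach_open_point convex_strictlyPositiveCone
    isOpen_strictlyPositiveCone hyU
  have hadd : ∀ x : selfAdjoint A, 0 ≤ (x : A) → ∀ ε : ℝ, 0 < ε → x + ε • 1 ∈ strictlyPositiveCone A := by
    intro x hx ε hε
    refine ⟨ε, hε, ?_⟩
    rw [Algebra.algebraMap_eq_smul_one]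
    exact le_add_of_nonneg_left hx
  have hneg : ∀ x : selfAdjoint A, 0 ≤ (x : A) → φ x ≤ 0 := by
    intro x hx
    by_contra! hpos
    have hyx : ∀ n : ℝ, 0 ≤ n → n * φ x + φ 1 < φ y' := by
      intro n hn
      have := hφ _ (hadd (n • x) (smul_nonneg hn hx) 1 one_pos)
      simpa using this
    have h1 := hyx ((|φ y'| + |φ 1|) / φ x) (by positivity)
    rw [div_mul_cancel₀ _ hpos.ne'] at h1
    linarith [le_abs_self (φ y'), neg_abs_le (φ 1)]
  have hφ1 : φ 1 < 0 := by
    have := hφ _ (hadd 0 le_rfl 1 one_pos)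
    simp only [zero_add, one_smul] at this
    exact this.trans_le (hneg y' hy)
  have hφy : 0 ≤ φ y' := by
    by_contra! h
    -- This multiple of 1 has the same value under `φ` as `y'`, against strict separation.
    have := hφ _ (hadd 0 le_rfl (φ y' / φ 1) (div_pos_of_neg_of_neg h hφ1))
    simp only [zero_add, map_smul, smul_eq_mul, div_mul_cancel₀ _ hφ1.ne, lt_self_iff_false] at this
  have hφy0 : φ y' = 0 := le_antisymm (hneg y' hy) hφy
  let ψ : selfAdjoint A →ₗ[ℝ] ℝ := (φ 1)⁻¹ • (φ : selfAdjoint A →ₗ[ℝ] ℝ)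
  let g : A →ₗ[ℂ] ℂ := Module.Dual.extendRCLike (ψ ∘ₗ realPart)
  have hg : ∀ x : selfAdjoint A, g x = ψ x := by
    intro x
    rw [Module.Dual.extendRCLike_apply]
    simp [realPart_I_smul]
  refine ⟨⟨PositiveLinearMap.mk₀ g ?_, ?_⟩, ?_⟩
  · intro x hx
    rw [hg ⟨x, IsSelfAdjoint.of_nonneg hx⟩]
    exact_mod_cast mul_nonneg_of_nonpos_of_nonpos (inv_nonpos.2 hφ1.le) (hneg _ hx)
  · change g ((1 : selfAdjoint A) : A) = 1
    rw [hg]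
    exact_mod_cast inv_mul_cancel₀ hφ1.ne
  · change g (y' : A) = 0
    rw [hg]
    simp [ψ, hφy0]

/-- Some state vanishes on the noninvertible positive element `(d - μ)²`, so `d - μ` kills its GNS
cyclic vector, which is one summand of the universal space. -/
theorem exists_unit_eigenvector {d : A} (hd : IsSelfAdjoint d) {μ : ℝ} (hμ : μ ∈ spectrum ℝ d) :
    ∃ ξ : UniversalSpace A, ‖ξ‖ = 1 ∧ universalRep d ξ = (μ : ℂ) • ξ := by
  classical
  set x : A := d - algebraMap ℝ A μ with hx
  have hxsa : IsSelfAdjoint x := hd.sub (IsSelfAdjoint.algebraMap A (IsSelfAdjoint.all μ))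
  have hxu : ¬ IsUnit x := by
    rw [spectrum.mem_iff] at hμ
    rwa [← IsUnit.neg_iff, hx, neg_sub]
  obtain ⟨f, hf⟩ := exists_state_apply_eq_zero (y := star x * x) (star_mul_self_nonneg x) (by
    rw [hxsa.star_eq, (Commute.refl x).isUnit_mul_iff]
    exact fun h => hxu h.1)
  let v : f.1.GNS := ((f.1.toPreGNS 1 : f.1.PreGNS) : UniformSpace.Completion f.1.PreGNS)
  have hv : ‖v‖ = 1 := by
    rw [UniformSpace.Completion.norm_coe, PositiveLinearMap.preGNS_norm_def]
    simp [f.2]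
  have hxv : f.1.gnsStarAlgHom x v = 0 := by
    have h1 : f.1.gnsStarAlgHom x v = ((f.1.toPreGNS x : f.1.PreGNS) : f.1.GNS) := by
      change f.1.gnsNonUnitalStarAlgHom x v = _
      rw [PositiveLinearMap.gnsNonUnitalStarAlgHom_apply_coe]
      simp
    rw [h1, ← norm_eq_zero, UniformSpace.Completion.norm_coe, PositiveLinearMap.preGNS_norm_def]
    simp [hf]
  have hdv : f.1.gnsStarAlgHom d v = (μ : ℂ) • v := by
    rw [hx, map_sub, sub_apply, sub_eq_zero] at hxv
    rw [hxv]
    have h1 : algebraMap ℝ A μ = algebraMap ℂ A (μ : ℂ) := by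
      rw [Algebra.algebraMap_eq_smul_one, Algebra.algebraMap_eq_smul_one, Complex.coe_smul]
    rw [h1, AlgHomClass.commutes]
    rfl
  refine ⟨lp.single 2 f v, ?_, ?_⟩
  · rw [lp.norm_single (by norm_num), hv]
  · ext g
    rw [universalRep_apply, lp.coeFn_smul, Pi.smul_apply]
    by_cases hg : g = f
    · subst hg
      simpa using hdv
    · simp [hg]
end States
end OperatorDisk

namespace OperatorDisk
open Filter Topology

/-! ### Infinite dimension forces an infinite spectrum -/

section InfiniteSpectrum

variable {A : Type*} [CStarAlgebra A]

/-- The sum of the `2⁻ᵐ e m` acts on the nonzero difference `e n - e (n + 1)` as the partial sum of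
`2⁻ᵐ` over `m ≤ n`, and these scalars are distinct. -/
theorem infinite_spectrum_of_strictAnti_projections {e : ℕ → A} (he : ∀ n, IsStarProjection (e n))
    (hmul : ∀ n, e (n + 1) * e n = e (n + 1)) (hne : ∀ n, e (n + 1) ≠ e n) :
    ∃ x : A, IsSelfAdjoint x ∧ (spectrum ℝ x).Infinite := by
  have hle : ∀ m n, n ≤ m → e m * e n = e m := by
    intro m n hmn
    induction m, hmn using Nat.le_induction with
    | base => exact (he n).isIdempotentElem
    | succ m _ ih => rw [← hmul m, mul_assoc, ih]
  have hle' : ∀ m n, n ≤ m → e n * e m = e m := by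
    intro m n hmn
    have := congrArg star (hle m n hmn)
    rwa [star_mul, (he m).isSelfAdjoint.star_eq, (he n).isSelfAdjoint.star_eq] at this
  let c : ℕ → ℝ := fun n => ∑ m ∈ Finset.range (n + 1), (1 / 2 : ℝ) ^ m
  have hc : StrictMono c := strictMono_nat_of_lt_succ fun n => by
    simp only [c]
    rw [Finset.sum_range_succ _ (n + 1)]
    exact lt_add_of_pos_right _ (by positivity)
  have hsum : Summable fun m => (1 / 2 : ℝ) ^ m • e m := by
    refine Summable.of_norm_bounded summable_geometric_two fun m => ?_
    rw [norm_smul, Real.norm_of_nonneg (by positivity)]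
    exact mul_le_of_le_one_right (by positivity) (IsStarProjection.norm_le _ (he m))
  refine ⟨∑' m, (1 / 2 : ℝ) ^ m • e m, ?_, ?_⟩
  · rw [IsSelfAdjoint, tsum_star]
    congr 1
    ext m
    rw [star_smul, (he m).isSelfAdjoint.star_eq, star_trivial]
  · refine (Set.infinite_range_of_injective hc.injective).mono ?_
    rintro _ ⟨n, rfl⟩
    rw [spectrum.mem_iff]
    intro hu
    have h0 : (algebraMap ℝ A (c n) - ∑' m, (1 / 2 : ℝ) ^ m • e m) * (e n - e (n + 1)) = 0 := by
      rw [sub_mul, sub_eq_zero, ← hsum.tsum_mul_right, tsum_eq_sum (s := Finset.range (n + 1))]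
      · rw [← Algebra.smul_def]
        simp only [c]
        rw [Finset.sum_smul]
        refine Finset.sum_congr rfl fun m hm => ?_
        have hm := Finset.mem_range.1 hm
        rw [smul_mul_assoc, mul_sub, hle' n m (by omega), hle' (n + 1) m (by omega)]
      · intro m hm
        have hm := Finset.mem_range.not.1 hm
        rw [smul_mul_assoc, mul_sub, hle m n (by omega), hle m (n + 1) (by omega), sub_self,
          smul_zero]
    rw [hu.mul_right_eq_zero, sub_eq_zero] at h0
    exact hne n h0.symm

/-- The minimal projections. -/
def IsMinimalProjection (p : A) : Prop :=
  IsStarProjection p ∧ ∀ e, IsStarProjection e → e * p = e → e = 0 ∨ e = p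

/-- Finite spectra exclude infinite descending chains of projections, so splitting a nonminimal
projection into two smaller ones terminates. -/
theorem mem_closure_isMinimalProjection
    (hfin : ∀ x : A, IsSelfAdjoint x → (spectrum ℝ x).Finite) {p : A} (hp : IsStarProjection p) :
    p ∈ AddSubmonoid.closure {q : A | IsMinimalProjection q} := by
  let r : {p : A // IsStarProjection p} → {p : A // IsStarProjection p} → Prop :=
    fun e p => e.1 * p.1 = e.1 ∧ e.1 ≠ p.1
  have hwf : WellFounded r := by
    rw [wellFounded_iff_isEmpty_descending_chain]
    refine ⟨fun ⟨f, hf⟩ => ?_⟩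
    obtain ⟨x, hx, hinf⟩ := infinite_spectrum_of_strictAnti_projections (e := fun n => (f n).1)
      (fun n => (f n).2) (fun n => (hf n).1) (fun n => (hf n).2)
    exact hinf (hfin x hx)
  suffices ∀ p : {p : A // IsStarProjection p},
      p.1 ∈ AddSubmonoid.closure {q : A | IsMinimalProjection q} from this ⟨p, hp⟩
  intro p
  induction p using hwf.induction with
  | _ p ih =>
    by_cases hmin : IsMinimalProjection p.1
    · exact AddSubmonoid.subset_closure hmin
    · have : ∃ e, IsStarProjection e ∧ e * p.1 = e ∧ e ≠ 0 ∧ e ≠ p.1 := by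
        by_contra! h
        refine hmin ⟨p.2, fun e he hep => ?_⟩
        by_cases h0 : e = 0
        · exact Or.inl h0
        · exact Or.inr (h e he hep h0)
      obtain ⟨e, he, hep, h0, h1⟩ := this
      have hpe : IsStarProjection (p.1 - e) := by
        have hep' : p.1 * e = e := by
          have := congrArg star hep
          rwa [star_mul, he.isSelfAdjoint.star_eq, p.2.isSelfAdjoint.star_eq] at this
        refine ⟨?_, p.2.isSelfAdjoint.sub he.isSelfAdjoint⟩
        rw [IsIdempotentElem, sub_mul, mul_sub, mul_sub, p.2.isIdempotentElem.eq,
          he.isIdempotentElem.eq, hep, hep', sub_self, sub_zero]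
      rw [← sub_add_cancel p.1 e]
      refine add_mem (ih ⟨p.1 - e, hpe⟩ ⟨?_, ?_⟩) (ih ⟨e, he⟩ ⟨hep, h1⟩)
      · change (p.1 - e) * p.1 = p.1 - e
        rw [sub_mul, hep, p.2.isIdempotentElem.eq]
      · change p.1 - e ≠ p.1
        simpa using h0

theorem IsMinimalProjection.exists_eq_smul_of_isSelfAdjoint {p z : A} (hp : IsMinimalProjection p)
    (hz : IsSelfAdjoint z) (hfin : (spectrum ℝ z).Finite) (hzp : z * p = z) :
    ∃ c : ℝ, z = c • p := by
  by_cases h : ∃ l ∈ spectrum ℝ z, l ≠ 0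
  · classical
    obtain ⟨l, hl, hl0⟩ := h
    -- On a finite spectrum every function is continuous, so `χ` gives the spectral projection at
    -- `l`; it lies below `p` and must equal it.
    let χ : ℝ → ℝ := fun x => if x = l then 1 else 0
    have hcont : ∀ f : ℝ → ℝ, ContinuousOn f (spectrum ℝ z) := fun f => hfin.continuousOn f
    have he : IsStarProjection (cfc χ z) := by
      refine ⟨?_, cfc_predicate χ z⟩
      rw [IsIdempotentElem, ← cfc_mul χ χ z (hcont _) (hcont _)]
      congr 1
      ext x
      simp [χ]
    have he0 : cfc χ z ≠ 0 := by
      intro h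
      have := norm_apply_le_norm_cfc χ z hl (hcont _)
      norm_num [χ, h] at this
    have hze : z * cfc χ z = l • cfc χ z := by
      conv_lhs => enter [1]; rw [← cfc_id' ℝ z]
      rw [← cfc_mul _ _ z (hcont _) (hcont _), ← cfc_const_mul l χ z (hcont _)]
      congr 1
      ext x
      by_cases hx : x = l <;> simp [χ, hx]
    have hep : cfc χ z * p = cfc χ z := by
      have h1 : cfc χ z = cfc (fun x => l⁻¹ * χ x) z * z := by
        conv_rhs => enter [2]; rw [← cfc_id' ℝ z]
        rw [← cfc_mul _ _ z (hcont _) (hcont _)]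
        congr 1
        ext x
        by_cases hx : x = l <;> simp [χ, hx, hl0]
      rw [h1, mul_assoc, hzp]
    have hcp := (hp.2 _ he hep).resolve_left he0
    refine ⟨l, ?_⟩
    rw [hcp, hzp] at hze
    exact hze
  · refine ⟨0, ?_⟩
    push Not at h
    rw [zero_smul, ← cfc_id' ℝ z, cfc_congr (g := fun _ => 0) fun x hx => h x hx, cfc_const_zero]

theorem IsMinimalProjection.exists_eq_smul {p : A} (hp : IsMinimalProjection p)
    (hfin : ∀ x : A, IsSelfAdjoint x → (spectrum ℝ x).Finite) (y : A) :
    ∃ c : ℂ, p * y * p = c • p := by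
  have key : ∀ x : selfAdjoint A, ∃ c : ℝ, p * x * p = c • p := by
    intro x
    have hx : IsSelfAdjoint (p * x * p) := by
      have := x.2.conjugate p
      rwa [hp.1.isSelfAdjoint.star_eq] at this
    refine hp.exists_eq_smul_of_isSelfAdjoint hx (hfin _ hx) ?_
    rw [mul_assoc, hp.1.isIdempotentElem.eq]
  obtain ⟨a, ha⟩ := key (realPart y)
  obtain ⟨b, hb⟩ := key (imaginaryPart y)
  refine ⟨a + Complex.I * b, ?_⟩
  conv_lhs => rw [← realPart_add_I_smul_imaginaryPart y]
  rw [mul_add, add_mul, ha, mul_smul_comm, smul_mul_assoc, hb, add_smul, mul_smul,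
    Complex.coe_smul, Complex.coe_smul]

/-- The corner `q A p` has dimension at most one: for a nonzero `w` in it, `w w*` is a nonzero
multiple of `q`, while `w* (q y p)` is a multiple of `p`. -/
theorem finiteDimensional_range_mulLeftRight {p q : A} (hp : IsMinimalProjection p)
    (hq : IsMinimalProjection q) (hfin : ∀ x : A, IsSelfAdjoint x → (spectrum ℝ x).Finite) :
    FiniteDimensional ℂ (LinearMap.mulLeftRight ℂ (q, p)).range := by
  suffices ∃ w : A, (LinearMap.mulLeftRight ℂ (q, p)).range ≤ Submodule.span ℂ {w} by
    obtain ⟨w, hw⟩ := this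
    exact Submodule.finiteDimensional_of_le hw
  by_cases h : ∃ x, q * x * p ≠ 0
  · obtain ⟨x, hx⟩ := h
    refine ⟨q * x * p, ?_⟩
    rintro _ ⟨y, rfl⟩
    rw [LinearMap.mulLeftRight_apply, Submodule.mem_span_singleton]
    have hps := hp.1.isSelfAdjoint.star_eq
    have hqs := hq.1.isSelfAdjoint.star_eq
    have hpp : p * p = p := hp.1.isIdempotentElem
    have hqq : q * q = q := hq.1.isIdempotentElem
    obtain ⟨c, hc⟩ := hq.exists_eq_smul hfin (x * p * star x)
    obtain ⟨d, hd⟩ := hp.exists_eq_smul hfin (star x * q * y)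
    have hww : (q * x * p) * star (q * x * p) = c • q := by
      rw [← hc]
      simp only [star_mul, hps, hqs, mul_assoc]
      rw [← mul_assoc p p, hpp]
    have hc0 : c ≠ 0 := by
      rintro rfl
      rw [zero_smul, CStarRing.mul_star_self_eq_zero_iff] at hww
      exact hx hww
    refine ⟨c⁻¹ * d, ?_⟩
    have h1 : c • (q * y * p) = d • (q * x * p) := by
      calc c • (q * y * p) = (c • q) * (q * y * p) := by
            rw [smul_mul_assoc]; simp only [← mul_assoc, hqq]
        _ = (q * x * p) * (p * (star x * q * y) * p) := by
            rw [← hww]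
            simp only [star_mul, hps, hqs, mul_assoc]
            rw [← mul_assoc q q, hqq, ← mul_assoc p p, hpp]
        _ = d • (q * x * p) := by
            rw [hd, mul_smul_comm, mul_assoc _ p p, hpp]
    rw [mul_smul, ← h1, smul_smul, inv_mul_cancel₀ hc0, one_smul]
  · push Not at h
    refine ⟨0, ?_⟩
    rintro _ ⟨y, rfl⟩
    simp [h]

/-- Otherwise 1 is a finite sum of minimal projections, and expanding both ones in `1 * x * 1`
exhibits the algebra as a finite sum of corners. -/
theorem exists_isSelfAdjoint_infinite_spectrum (hA : ¬ FiniteDimensional ℂ A) :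
    ∃ x : A, IsSelfAdjoint x ∧ (spectrum ℝ x).Infinite := by
  by_contra! hfin
  have hadd : ∀ f g : A →ₗ[ℂ] A, FiniteDimensional ℂ f.range → FiniteDimensional ℂ g.range →
      FiniteDimensional ℂ (f + g).range := by
    intro f g hf hg
    refine Submodule.finiteDimensional_of_le (S₂ := f.range ⊔ g.range) ?_
    rintro _ ⟨x, rfl⟩
    exact Submodule.add_mem_sup ⟨x, rfl⟩ ⟨x, rfl⟩
  have hzero : FiniteDimensional ℂ (0 : A →ₗ[ℂ] A).range := by
    rw [LinearMap.range_zero]; infer_instance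
  have h1 : (1 : A) ∈ AddSubmonoid.closure {q : A | IsMinimalProjection q} :=
    mem_closure_isMinimalProjection hfin (.one A)
  have hr : ∀ q, IsMinimalProjection q →
      FiniteDimensional ℂ (LinearMap.mulLeftRight ℂ (q, (1 : A))).range := by
    intro q hq
    refine AddSubmonoid.closure_induction
      (motive := fun v _ => FiniteDimensional ℂ (LinearMap.mulLeftRight ℂ (q, v)).range)
      ?_ ?_ ?_ h1
    · exact fun p hp => finiteDimensional_range_mulLeftRight hp hq hfin
    · have h : LinearMap.mulLeftRight ℂ (q, (0 : A)) = 0 := by ext; simp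
      rwa [h]
    · intro u v _ _ hu hv
      have h : LinearMap.mulLeftRight ℂ (q, u + v) =
          LinearMap.mulLeftRight ℂ (q, u) + LinearMap.mulLeftRight ℂ (q, v) := by
        ext; simp [mul_add]
      rw [h]
      exact hadd _ _ hu hv
  have hl : FiniteDimensional ℂ (LinearMap.mulLeftRight ℂ ((1 : A), (1 : A))).range := by
    refine AddSubmonoid.closure_induction
      (motive := fun v _ => FiniteDimensional ℂ (LinearMap.mulLeftRight ℂ (v, (1 : A))).range)
      ?_ ?_ ?_ h1
    · exact hr
    · have h : LinearMap.mulLeftRight ℂ ((0 : A), (1 : A)) = 0 := by ext; simp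
      rwa [h]
    · intro u v _ _ hu hv
      have h : LinearMap.mulLeftRight ℂ (u + v, (1 : A)) =
          LinearMap.mulLeftRight ℂ (u, 1) + LinearMap.mulLeftRight ℂ (v, 1) := by
        ext; simp [add_mul]
      rw [h]
      exact hadd _ _ hu hv
  have : (LinearMap.mulLeftRight ℂ ((1 : A), (1 : A))).range = ⊤ := by
    rw [LinearMap.range_eq_top]
    exact fun x => ⟨x, by simp⟩
  rw [this] at hl
  exact hA (Submodule.topEquiv.finiteDimensional)

end InfiniteSpectrum
end OperatorDisk

namespace OperatorDisk
open Filter Topology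

/-! ### A norm-one element whose defect has nonclosed range -/

section ClosedRange

/-- The open mapping theorem gives `x` with `d x = d (d w)` and controlled norm; self-adjointness
gives `‖d w‖² = ⟪d w, x⟫`. -/
theorem exists_norm_le_of_isClosed_range {H : Type*} [NormedAddCommGroup H] [InnerProductSpace ℂ H]
    [CompleteSpace H] {d : H →L[ℂ] H} (hd : IsSelfAdjoint d) (hcl : IsClosed (Set.range d)) :
    ∃ C : ℝ, ∀ w, ‖d w‖ ≤ C * ‖d (d w)‖ := by
  have : CompleteSpace d.range := IsClosed.completeSpace_coe (hs := by rwa [LinearMap.coe_range])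
  obtain ⟨C, hC, h⟩ := ContinuousLinearMap.exists_preimage_norm_le d.rangeRestrict
    (LinearMap.surjective_rangeRestrict _)
  refine ⟨C, fun w => ?_⟩
  obtain ⟨x, hx, hxC⟩ := h ⟨d (d w), ⟨d w, rfl⟩⟩
  have hx : d x = d (d w) := congrArg Subtype.val hx
  have hxC : ‖x‖ ≤ C * ‖d (d w)‖ := hxC
  have hinner : inner ℂ (d w) (d w) = inner ℂ (d w) x := by
    have hsymm : ∀ x y, inner ℂ (d x) y = inner ℂ x (d y) := hd.isSymmetric
    rw [hsymm w (d w), hsymm w x, hx]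
  have h1 : ‖d w‖ * ‖d w‖ ≤ ‖d w‖ * ‖x‖ := by
    rw [← inner_self_eq_norm_mul_norm (𝕜 := ℂ), hinner]
    exact (RCLike.re_le_norm _).trans (norm_inner_le_norm _ _)
  rcases (norm_nonneg (d w)).eq_or_lt with h0 | h0
  · rw [← h0]; positivity
  · exact (le_of_mul_le_mul_left h1 h0).trans hxC

theorem exists_isSelfAdjoint_accPt_spectrum {A : Type*} [CStarAlgebra A]
    (hA : ¬ FiniteDimensional ℂ A) :
    ∃ x : A, IsSelfAdjoint x ∧ ∃ l ∈ spectrum ℝ x, AccPt l (𝓟 (spectrum ℝ x)) := by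
  obtain ⟨x, hx, hinf⟩ := exists_isSelfAdjoint_infinite_spectrum hA
  obtain ⟨l, hl, hacc⟩ := hinf.exists_accPt_of_subset_isCompact
    (ContinuousFunctionalCalculus.isCompact_spectrum x) subset_rfl
  exact ⟨x, hx, l, hl, hacc⟩

theorem exists_not_isClosed_range {H A : Type*} [NormedAddCommGroup H] [InnerProductSpace ℂ H]
    [CompleteSpace H] [CStarAlgebra A] (π : A →⋆ₐ[ℂ] (H →L[ℂ] H))
    (hπ : ∀ d : A, IsSelfAdjoint d → ∀ μ ∈ spectrum ℝ d, ∃ ξ, ‖ξ‖ = 1 ∧ π d ξ = (μ : ℂ) • ξ)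
    (hA : ¬ FiniteDimensional ℂ A) :
    ∃ a : A, ‖π a‖ = 1 ∧ ¬ IsClosed (Set.range (1 - star (π a) * π a : H →L[ℂ] H)) := by
  obtain ⟨x, hx, l, hl, hacc⟩ := exists_isSelfAdjoint_accPt_spectrum hA
  -- Any continuous function with values in `(0, 1]` that equals 1 only at `l` would serve.
  let φ : ℝ → ℝ := fun y => (1 + (y - l) ^ 2)⁻¹
  have hpos : ∀ y, 0 < 1 + (y - l) ^ 2 := fun y => by positivity
  have hφc : Continuous φ :=
    (by fun_prop : Continuous fun y : ℝ => 1 + (y - l) ^ 2).inv₀ fun y => (hpos y).ne'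
  have hφ1 : ∀ y, φ y ≤ 1 := fun y => inv_le_one_of_one_le₀ (by linarith [sq_nonneg (y - l)])
  have hφ0 : ∀ y, 0 < φ y := fun y => inv_pos.2 (hpos y)
  have hφl : φ l = 1 := by simp [φ]
  have hφlt : ∀ y, y ≠ l → φ y < 1 := fun y hy =>
    inv_lt_one_of_one_lt₀ (by have : y - l ≠ 0 := sub_ne_zero.2 hy; linarith [sq_pos_of_ne_zero this])
  let ψ : ℝ → ℝ := fun y => 1 - φ y * φ y
  have hψc : Continuous ψ := continuous_const.sub (hφc.mul hφc)
  set a : A := cfc φ x with ha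
  have hasa : IsSelfAdjoint a := cfc_predicate φ x
  have hd : 1 - star a * a = cfc ψ x := by
    change _ = cfc (fun y => (1 : ℝ) - φ y * φ y) x
    rw [hasa.star_eq, cfc_sub (fun _ => 1) (fun y => φ y * φ y) x (hg := (hφc.mul hφc).continuousOn),
      cfc_const_one ℝ x, cfc_mul φ φ x hφc.continuousOn hφc.continuousOn]
  have hspec : ∀ y ∈ spectrum ℝ x, ψ y ∈ spectrum ℝ (cfc ψ x) := by
    intro y hy
    rw [cfc_map_spectrum ψ x (hf := hψc.continuousOn)]
    exact ⟨y, hy, rfl⟩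
  have hdsa : IsSelfAdjoint (cfc ψ x) := cfc_predicate ψ x
  refine ⟨a, le_antisymm ?_ ?_, fun hcl => ?_⟩
  · refine (NonUnitalStarAlgHom.norm_apply_le π a).trans (norm_cfc_le zero_le_one fun y _ => ?_)
    rw [Real.norm_of_nonneg (hφ0 y).le]
    exact hφ1 y
  · have h1 : φ l ∈ spectrum ℝ a := by
      rw [ha, cfc_map_spectrum φ x (hf := hφc.continuousOn)]
      exact ⟨l, hl, rfl⟩
    obtain ⟨ξ, hξ, hξ'⟩ := hπ a hasa _ h1
    have := (π a).le_opNorm ξ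
    rw [hξ', hφl, hξ] at this
    simpa [hξ] using this
  · have hπd : 1 - star (π a) * π a = π (cfc ψ x) := by
      rw [← hd, map_sub, map_mul, map_star, map_one]
    rw [hπd] at hcl
    obtain ⟨C, hC⟩ := exists_norm_le_of_isClosed_range (hdsa.map π) hcl
    -- Tested on an eigenvector, the closed-range estimate bounds the nonzero eigenvalues `ψ y` away
    -- from 0, but `ψ y` tends to 0 as `y` tends to `l`.
    have hkey : ∀ y ∈ spectrum ℝ x, y ≠ l → 1 ≤ C * ψ y := by
      intro y hy hyl
      have hψ : 0 < ψ y := by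
        simp only [ψ]
        nlinarith [hφ0 y, hφlt y hyl]
      obtain ⟨ξ, hξ, hξ'⟩ := hπ _ hdsa _ (hspec y hy)
      have := hC ξ
      rw [hξ', map_smul, hξ', norm_smul, norm_smul, norm_smul, hξ, Complex.norm_real,
        Real.norm_of_nonneg hψ.le, mul_one, ← mul_assoc] at this
      exact (le_mul_iff_one_le_left hψ).1 this
    have hlim : Tendsto (fun y => C * ψ y) (𝓝 l) (𝓝 0) := by
      have := (hψc.const_mul C).tendsto l
      simpa [ψ, hφl] using this
    have hev := hlim.eventually (gt_mem_nhds one_pos)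
    obtain ⟨y, ⟨hyl, hy⟩, hlt⟩ := ((accPt_iff_frequently.1 hacc).and_eventually hev).exists
    exact absurd (hkey y hy hyl) (not_le.2 hlt)

end ClosedRange

end OperatorDisk

/-! ### The theorem; the counterexample already lies in the image of `A` -/

theorem proposition7 {A : Type*} [CStarAlgebra A] [PartialOrder A] [StarOrderedRing A] :
    (∀ a : OperatorDisk.Bidual A, OperatorDisk.IsLimitPoint a →
      (∃ h q : OperatorDisk.Bidual A,
        (h : OperatorDisk.UniversalSpace A →L[ℂ] OperatorDisk.UniversalSpace A).IsPositive ∧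
        IsUnit h ∧ IsStarProjection q ∧ 1 - star a * a = h * q * h) ∧
      IsClosed (Set.range ((1 - star a * a : OperatorDisk.Bidual A) :
        OperatorDisk.UniversalSpace A →L[ℂ] OperatorDisk.UniversalSpace A))) ∧
    (¬ FiniteDimensional ℂ A →
      ∃ a : OperatorDisk.Bidual A,
        ‖(a : OperatorDisk.UniversalSpace A →L[ℂ] OperatorDisk.UniversalSpace A)‖ = 1 ∧
        ¬ IsClosed (Set.range ((1 - star a * a : OperatorDisk.Bidual A) :
          OperatorDisk.UniversalSpace A →L[ℂ] OperatorDisk.UniversalSpace A)) ∧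
        ¬ OperatorDisk.IsLimitPoint a) := by
  have first : ∀ a : OperatorDisk.Bidual A, OperatorDisk.IsLimitPoint a →
      (∃ h q : OperatorDisk.Bidual A,
        (h : OperatorDisk.UniversalSpace A →L[ℂ] OperatorDisk.UniversalSpace A).IsPositive ∧
        IsUnit h ∧ IsStarProjection q ∧ 1 - star a * a = h * q * h) ∧
      IsClosed (Set.range ((1 - star a * a : OperatorDisk.Bidual A) :
        OperatorDisk.UniversalSpace A →L[ℂ] OperatorDisk.UniversalSpace A)) := by
    rintro a ⟨δ, hδ, hlim⟩
    exact OperatorDisk.defect_of_isGeodesic (OperatorDisk.Bidual A) (OperatorDisk.universalHom A)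
      OperatorDisk.universalRep_mem_bidual hδ a hlim
  refine ⟨first, fun hA => ?_⟩
  obtain ⟨a, ha, hcl⟩ := OperatorDisk.exists_not_isClosed_range (OperatorDisk.universalHom A)
    (fun d hd μ hμ => OperatorDisk.exists_unit_eigenvector hd hμ) hA
  exact ⟨⟨_, OperatorDisk.universalRep_mem_bidual a⟩, ha, hcl, fun h => hcl (first _ h).2⟩
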